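/- Let $k,n\ge 1$ be natural numbers and let $K=\bigcup_{i=1}^k K_i\subset\mathbb{R}^n$ be the union of $k$ compact, path-connected (in particular non-empty), pairwise disjoint sets $K_i$. A linear functional $L:\mathcal V\to\mathbb R$ on a vector space of real functions on a set $\mathcal X\subseteq\mathbb R^m$ is called an $S$-moment functional ($S\subseteq\mathcal X$) if there is a non-negative Borel measure $\mu$ on $\mathcal X$ with $\operatorname{supp}\mu\subseteq S$ such that every $v\in\mathcal V$ is $\mu$-integrable and $L(v)=\int v\,d\mu$. For $g:K\to\mathbb R$ let $\mathbb R[g]=\{p\circ g: p\in\mathbb R[t]\}$. Then there exists a Borel measurable function $$g:K\to I_k:=\bigcup_{i=1}^{k}\left[\frac{2i-2}{2k-1},\frac{2i-1}{2k-1}\right]\subseteq[0,1]$$ such that for every linear subspace $\mathcal V\subseteq C(K,\mathbb R)$ with $1\in\mathcal V$ and every linear functional $L:\mathcal V\to\mathbb R$ the following are equivalent: (i) $L$ is a $K$-moment functional. (ii) $L$ extends continuously to a linear functional $\overline L:\mathcal V+\mathbb R[g]\to\mathbb R$ such that the linear functional $\tilde L:\mathbb R[t]\to\mathbb R$ defined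 by $\tilde L(t^d):=\overline L(g^d)$ for all $d\in\mathbb N_0$ is a $[0,1]$-moment functional. Here "extends continuously" means: $\overline L|_{\mathcal V}=L$, and whenever $p_j\in\mathbb R[t]$ $(j\in\mathbb N)$ converge uniformly on $[0,1]$ to some $p\in C([0,1],\mathbb R)$ with $p\circ g\in\mathcal V$, then $\overline L(p_j\circ g)\to L(p\circ g)$. -/

import Mathlib

open Filter Topology MeasureTheory Polynomial

/-- A linear functional `L` on a vector space `V` whose elements are regarded as real functions on
`X` (through the linear map `ev`) is a moment functional if it is represented by a (non-negative)
measure on `X`: every member of `V` is integrable, and `L` is integration. -/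
def IsMomentFunctional {X V : Type*} [MeasurableSpace X] [AddCommGroup V] [Module ℝ V]
    (ev : V →ₗ[ℝ] (X → ℝ)) (L : V →ₗ[ℝ] ℝ) : Prop :=
  ∃ μ : Measure X, ∀ v : V, Integrable (ev v) μ ∧ L v = ∫ x, ev v x ∂μ

/-- The same with a representing measure whose support lies in `S ⊆ X`: an `S`-moment
functional. -/
def IsMomentFunctionalOn {X V : Type*} [TopologicalSpace X] [MeasurableSpace X]
    [AddCommGroup V] [Module ℝ V]
    (S : Set X) (ev : V →ₗ[ℝ] (X → ℝ)) (L : V →ₗ[ℝ] ℝ) : Prop :=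
  ∃ μ : Measure X, μ.support ⊆ S ∧ ∀ v : V, Integrable (ev v) μ ∧ L v = ∫ x, ev v x ∂μ

/-- The linear map `p ↦ p ∘ g` from real polynomials in one variable to functions on `X`. -/
noncomputable def polyComp {X : Type*} (g : X → ℝ) : ℝ[X] →ₗ[ℝ] (X → ℝ) :=
  LinearMap.pi fun x => Polynomial.leval (g x)

/-- `ℝ[g]`: the space of all functions `p ∘ g`, with `p` a real polynomial in one variable. -/
noncomputable def polySpace {X : Type*} (g : X → ℝ) : Submodule ℝ (X → ℝ) :=
  LinearMap.range (polyComp g)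

/-- For a linear functional `Lbar` on `V + ℝ[g]`, the linear functional `p ↦ Lbar (p ∘ g)` on
polynomials, i.e. the one determined by `t ^ d ↦ Lbar (g ^ d)`. -/
noncomputable def inducedFunctional {X : Type*} {V : Submodule ℝ (X → ℝ)} {g : X → ℝ}
    (Lbar : ↥(V ⊔ polySpace g) →ₗ[ℝ] ℝ) : ℝ[X] →ₗ[ℝ] ℝ :=
  Lbar ∘ₗ Submodule.inclusion (le_sup_right : polySpace g ≤ V ⊔ polySpace g) ∘ₗ
    (polyComp g).rangeRestrict

/-- `Lbar` is a continuous extension of `L : V → ℝ` to `V + ℝ[g]`: it agrees with `L` on `V`, and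
whenever polynomials `P i` converge uniformly on `[0,1]` to a continuous function `p` with
`p ∘ g = v ∈ V`, then `Lbar (P i ∘ g)` converges to `L v`. -/
structure IsContinuousExtension {X : Type*} {V : Submodule ℝ (X → ℝ)} (g : X → ℝ)
    (L : V →ₗ[ℝ] ℝ) (Lbar : ↥(V ⊔ polySpace g) →ₗ[ℝ] ℝ) : Prop where
  extends_L : ∀ v : V, Lbar (Submodule.inclusion le_sup_left v) = L v
  tendsto : ∀ (P : ℕ → ℝ[X]) (p : ℝ → ℝ) (v : V),
    ContinuousOn p (Set.Icc 0 1) →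
    TendstoUniformlyOn (fun i t => (P i).eval t) p atTop (Set.Icc 0 1) →
    (∀ x, (v : X → ℝ) x = p (g x)) →
    Tendsto (fun i => inducedFunctional Lbar (P i)) atTop (𝓝 (L v))

/-- `I_k`, the union of the intervals `[(2i-2)/(2k-1), (2i-1)/(2k-1)]` for `i = 1, …, k`. -/
def intervalUnion (k : ℕ) : Set ℝ :=
  ⋃ i ∈ Finset.Icc 1 k,
    Set.Icc ((2 * (i : ℝ) - 2) / (2 * (k : ℝ) - 1)) ((2 * (i : ℝ) - 1) / (2 * (k : ℝ) - 1))

/-! The nonempty compact metrizable space `K` is a continuous image `f` of the Cantor space, which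
embeds by `e` into the first interval of `I_k`. Take `g = e ∘ s` with `s` a section of `f` chosen so
that `g` is Borel. A representing measure of `L` extends `L` by integration. Conversely, by
Weierstrass approximation a measure `ν` on `[0,1]` representing the polynomial functional also
computes `L (p ∘ g)` for continuous `p`. This forces `ν` to live on the range of `e`, so it can be
pulled back along `e` and pushed forward along `f` to `K`. Every `v ∈ V` has the form `q ∘ g` with
`q` continuous, by Tietze applied to `v ∘ f`. -/

/-- Integrals against a finite measure converge along almost everywhere uniformly convergent
sequences. -/
theorem tendsto_integral_of_forall_eventually_ae_le {α : Type*} [MeasurableSpace α] {μ : Measure α}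
    [IsFiniteMeasure μ] {F : ℕ → α → ℝ} {f : α → ℝ} (hF : ∀ i, Integrable (F i) μ)
    (hf : Integrable f μ) (h : ∀ ε > 0, ∀ᶠ i in atTop, ∀ᵐ x ∂μ, |F i x - f x| ≤ ε) :
    Tendsto (fun i => ∫ x, F i x ∂μ) atTop (𝓝 (∫ x, f x ∂μ)) := by
  rw [Metric.tendsto_nhds]
  intro ε hε
  have hpos : 0 < μ.real Set.univ + 1 := by positivity
  filter_upwards [h (ε / (μ.real Set.univ + 1)) (by positivity)] with i hi
  rw [Real.dist_eq, ← integral_sub (hF i) hf]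
  calc |∫ x, (F i x - f x) ∂μ| ≤ ε / (μ.real Set.univ + 1) * μ.real Set.univ :=
        norm_integral_le_of_norm_le_const (f := fun x => F i x - f x) hi
    _ < ε / (μ.real Set.univ + 1) * (μ.real Set.univ + 1) := by gcongr; linarith
    _ = ε := by field_simp

theorem Continuous.integrable_of_compactSpace {X : Type*} [TopologicalSpace X] [CompactSpace X]
    [MeasurableSpace X] [BorelSpace X] {μ : Measure X} [IsFiniteMeasure μ] {v : X → ℝ}
    (hv : Continuous v) : Integrable v μ :=
  (BoundedContinuousFunction.mkOfCompact ⟨v, hv⟩).integrable μ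

/-- A continuous function on `ℝ` is integrable against a finite measure living on `[0,1]`. -/
theorem Continuous.integrable_of_ae_mem_Icc {ν : Measure ℝ} [IsFiniteMeasure ν]
    (hν : ∀ᵐ t ∂ν, t ∈ Set.Icc (0 : ℝ) 1) {q : ℝ → ℝ} (hq : Continuous q) : Integrable q ν := by
  obtain ⟨B, hB⟩ := isCompact_Icc.exists_bound_of_continuousOn
    (hq.continuousOn (s := Set.Icc (0 : ℝ) 1))
  refine Integrable.of_bound hq.aestronglyMeasurable B ?_
  filter_upwards [hν] with t ht using hB t ht

/-- The least section of a continuous surjection, seen through an embedding of the compact domain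
into the line, is Borel measurable. -/
theorem exists_measurable_section {X Z : Type*} [TopologicalSpace X] [T2Space X]
    [MeasurableSpace X] [BorelSpace X] [TopologicalSpace Z] [CompactSpace Z]
    {f : Z → X} (hf : Continuous f) (hsurj : Function.Surjective f)
    {e : Z → ℝ} (he : Continuous e) :
    ∃ s : X → Z, (∀ x, f (s x) = x) ∧ Measurable (e ∘ s) := by
  have hmin : ∀ x, ∃ z, f z = x ∧ ∀ w, f w = x → e z ≤ e w := by
    intro x
    obtain ⟨z, hz, hzmin⟩ := ((isClosed_singleton (x := x)).preimage hf).isCompact.exists_isMinOn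
      (hsurj x) he.continuousOn
    exact ⟨z, hz, fun w hw => hzmin hw⟩
  choose s hs hsmin using hmin
  refine ⟨s, hs, measurable_of_Iic fun a => ?_⟩
  -- Since `s x` minimizes `e` on the fibre over `x`, a sublevel set of `e ∘ s` is the image of a
  -- compact sublevel set of `e`, hence closed.
  have : (e ∘ s) ⁻¹' Set.Iic a = f '' (e ⁻¹' Set.Iic a) := by
    ext x
    constructor
    · exact fun h => ⟨s x, h, hs x⟩
    · rintro ⟨z, hz, rfl⟩
      exact (hsmin (f z) z rfl).trans hz
  rw [this]
  exact (((isClosed_Iic.preimage he).isCompact.image hf).isClosed).measurableSet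

theorem intervalUnion_subset_Icc {k : ℕ} : intervalUnion k ⊆ Set.Icc 0 1 := by
  intro t ht
  simp only [intervalUnion, Set.mem_iUnion, Finset.mem_Icc, Set.mem_Icc, exists_prop] at ht
  obtain ⟨i, ⟨hi, hik⟩, h1, h2⟩ := ht
  have hi' : (1 : ℝ) ≤ i := by exact_mod_cast hi
  have hik' : (i : ℝ) ≤ k := by exact_mod_cast hik
  constructor
  · exact (div_nonneg (by linarith) (by linarith)).trans h1
  · exact h2.trans ((div_le_one (by linarith)).2 (by linarith))

/-- The Cantor space embeds into the first interval of `I_k`. -/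
theorem exists_isClosedEmbedding_intervalUnion {k : ℕ} (hk : 1 ≤ k) :
    ∃ e : (ℕ → Bool) → ℝ, IsClosedEmbedding e ∧ ∀ z, e z ∈ intervalUnion k := by
  have hk' : (1 : ℝ) ≤ k := by exact_mod_cast hk
  have hpos : (0 : ℝ) < 2 * k - 1 := by linarith
  -- Dividing the Cantor set by `2k - 1` puts it in the interval with `i = 1`.
  refine ⟨fun z => (cantorSetHomeomorphNatToBool.symm z : ℝ) / (2 * k - 1), ?_, fun z => ?_⟩
  · refine Continuous.isClosedEmbedding (by fun_prop) fun a b hab => ?_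
    have : (cantorSetHomeomorphNatToBool.symm a : ℝ) = cantorSetHomeomorphNatToBool.symm b :=
      (div_left_inj' hpos.ne').1 hab
    exact cantorSetHomeomorphNatToBool.symm.injective (Subtype.ext this)
  · obtain ⟨h0, h1⟩ := cantorSet_subset_unitInterval (cantorSetHomeomorphNatToBool.symm z).2
    simp only [intervalUnion, Set.mem_iUnion, Finset.mem_Icc, Set.mem_Icc, exists_prop]
    refine ⟨1, ⟨le_rfl, hk⟩, ?_, ?_⟩
    · norm_num
      positivity
    · push_cast
      gcongr
      linarith

section

variable {X : Type*}

@[simp]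
theorem polyComp_apply (g : X → ℝ) (p : ℝ[X]) (x : X) : polyComp g p x = p.eval (g x) := rfl

theorem integrable_of_mem_sup_polySpace [MeasurableSpace X] {μ : Measure X} [IsFiniteMeasure μ]
    {V : Submodule ℝ (X → ℝ)} {g : X → ℝ} (hg : Measurable g) (hgI : ∀ x, g x ∈ Set.Icc (0 : ℝ) 1)
    (hV : ∀ v ∈ V, Integrable v μ) {w : X → ℝ} (hw : w ∈ V ⊔ polySpace g) : Integrable w μ := by
  obtain ⟨v, hv, _, ⟨p, rfl⟩, rfl⟩ := Submodule.mem_sup.1 hw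
  refine (hV v hv).add ?_
  obtain ⟨B, hB⟩ := isCompact_Icc.exists_bound_of_continuousOn
    (p.continuous.continuousOn (s := Set.Icc (0 : ℝ) 1))
  exact Integrable.of_bound (p.continuous.measurable.comp hg).aestronglyMeasurable B
    (.of_forall fun x => hB _ (hgI x))

/-- Integration against a representing measure is a continuous extension of a moment functional. -/
theorem IsMomentFunctional.exists_continuousExtension [MeasurableSpace X]
    {V : Submodule ℝ (X → ℝ)} {g : X → ℝ} (hg : Measurable g) (hgI : ∀ x, g x ∈ Set.Icc (0 : ℝ) 1)
    (h1 : (1 : X → ℝ) ∈ V) {L : V →ₗ[ℝ] ℝ} (hL : IsMomentFunctional V.subtype L) :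
    ∃ Lbar : ↥(V ⊔ polySpace g) →ₗ[ℝ] ℝ, IsContinuousExtension g L Lbar ∧
      IsMomentFunctionalOn (Set.Icc 0 1) (polyComp (id : ℝ → ℝ)) (inducedFunctional Lbar) := by
  obtain ⟨μ, hμ⟩ := hL
  have : IsFiniteMeasure μ :=
    (integrable_const_iff_isFiniteMeasure (one_ne_zero (α := ℝ))).1 (hμ ⟨1, h1⟩).1
  have hint : ∀ w : ↥(V ⊔ polySpace g), Integrable (w : X → ℝ) μ := fun w =>
    integrable_of_mem_sup_polySpace hg hgI (fun v hv => (hμ ⟨v, hv⟩).1) w.2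
  let Lbar : ↥(V ⊔ polySpace g) →ₗ[ℝ] ℝ :=
    { toFun := fun w => ∫ x, (w : X → ℝ) x ∂μ
      map_add' := fun a b => integral_add (hint a) (hint b)
      map_smul' := fun c a => integral_const_mul c _ }
  have hind : ∀ p : ℝ[X], inducedFunctional Lbar p = ∫ x, p.eval (g x) ∂μ := fun p => rfl
  have hintp : ∀ p : ℝ[X], Integrable (fun x => p.eval (g x)) μ := fun p =>
    hint ⟨polyComp g p, Submodule.mem_sup_right ⟨p, rfl⟩⟩
  refine ⟨Lbar, ⟨fun v => ((hμ v).2).symm, fun P p v _ hP hv => ?_⟩, μ.map g, ?_, fun p => ?_⟩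
  · simp only [hind]
    rw [(hμ v).2]
    refine tendsto_integral_of_forall_eventually_ae_le (fun i => hintp _) (hμ v).1 fun ε hε => ?_
    filter_upwards [Metric.tendstoUniformlyOn_iff.1 hP ε hε] with i hi
    refine .of_forall fun x => ?_
    have := hi (g x) (hgI x)
    rw [dist_comm, Real.dist_eq] at this
    rw [V.subtype_apply, hv x]
    exact this.le
  · refine Measure.support_subset_of_isClosed isClosed_Icc ?_
    exact (ae_map_iff hg.aemeasurable measurableSet_Icc).2 (.of_forall hgI)
  · have hm : AEStronglyMeasurable (polyComp (id : ℝ → ℝ) p) (μ.map g) :=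
      p.continuous.aestronglyMeasurable
    exact ⟨(integrable_map_measure hm hg.aemeasurable).2 (hintp p),
      (integral_map hg.aemeasurable hm).symm⟩

/-- If the polynomial functional of a continuous extension of `L` is represented by a measure `ν` on
`[0,1]`, then `ν` integrates every continuous `p` with `p ∘ g ∈ V` to `L (p ∘ g)`. -/
theorem IsContinuousExtension.apply_eq_integral {V : Submodule ℝ (X → ℝ)} {g : X → ℝ}
    {L : V →ₗ[ℝ] ℝ} {Lbar : ↥(V ⊔ polySpace g) →ₗ[ℝ] ℝ} (hLbar : IsContinuousExtension g L Lbar)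
    {ν : Measure ℝ} [IsFiniteMeasure ν] (hνI : ∀ᵐ t ∂ν, t ∈ Set.Icc (0 : ℝ) 1)
    (hν : ∀ p : ℝ[X], inducedFunctional Lbar p = ∫ t, p.eval t ∂ν)
    {p : ℝ → ℝ} (hp : Continuous p) (v : V) (hv : ∀ x, (v : X → ℝ) x = p (g x)) :
    L v = ∫ t, p t ∂ν := by
  -- Weierstrass: `P i` is within `1 / (i + 1)` of `p` on `[0,1]`.
  choose P hP using fun i : ℕ => exists_polynomial_near_of_continuousOn 0 1 p hp.continuousOn
    (1 / ((i : ℝ) + 1)) (by positivity)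
  have hunif : ∀ ε > 0, ∀ᶠ i in atTop, ∀ t ∈ Set.Icc (0 : ℝ) 1, |(P i).eval t - p t| < ε := by
    intro ε hε
    filter_upwards [tendsto_one_div_add_atTop_nhds_zero_nat.eventually_lt_const hε] with i hi t ht
    exact (hP i t ht).trans hi
  refine tendsto_nhds_unique (hLbar.tendsto P p v hp.continuousOn ?_ hv) ?_
  · refine Metric.tendstoUniformlyOn_iff.2 fun ε hε => ?_
    filter_upwards [hunif ε hε] with i hi t ht
    rw [dist_comm, Real.dist_eq]
    exact hi t ht
  · simp only [hν]
    refine tendsto_integral_of_forall_eventually_ae_le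
      (fun i => (P i).continuous.integrable_of_ae_mem_Icc hνI) (hp.integrable_of_ae_mem_Icc hνI)
      fun ε hε => ?_
    filter_upwards [hunif ε hε] with i hi
    filter_upwards [hνI] with t ht using (hi t ht).le

/-- Let `f : Z → X` be a continuous map with section `s` and `e : Z → ℝ` a closed embedding. Along
`g = e ∘ s`, a functional on continuous functions whose continuous extension is a `[0,1]`-moment
functional is itself a moment functional. -/
theorem IsContinuousExtension.isMomentFunctional {Z : Type*} [TopologicalSpace X] [CompactSpace X]
    [MeasurableSpace X] [BorelSpace X] [TopologicalSpace Z] [Nonempty Z] [MeasurableSpace Z]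
    [BorelSpace Z] {f : Z → X} (hf : Continuous f) {e : Z → ℝ} (he : IsClosedEmbedding e)
    {s : X → Z} (hs : ∀ x, f (s x) = x) {V : Submodule ℝ (X → ℝ)} (h1 : (1 : X → ℝ) ∈ V)
    (hV : ∀ v ∈ V, Continuous v) {L : V →ₗ[ℝ] ℝ} {Lbar : ↥(V ⊔ polySpace (e ∘ s)) →ₗ[ℝ] ℝ}
    (hLbar : IsContinuousExtension (e ∘ s) L Lbar)
    (hmom : IsMomentFunctionalOn (Set.Icc 0 1) (polyComp (id : ℝ → ℝ)) (inducedFunctional Lbar)) :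
    IsMomentFunctional V.subtype L := by
  obtain ⟨ν, hsupp, hν⟩ := hmom
  have : IsFiniteMeasure ν := by
    refine (integrable_const_iff_isFiniteMeasure (one_ne_zero (α := ℝ))).1 ?_
    convert (hν 1).1 using 1
    ext t
    simp
  have hνI : ∀ᵐ t ∂ν, t ∈ Set.Icc (0 : ℝ) 1 := mem_of_superset Measure.support_mem_ae hsupp
  have hrep {p : ℝ → ℝ} (hp : Continuous p) (v : V) (hv : ∀ x, (v : X → ℝ) x = p (e (s x))) :
      L v = ∫ t, p t ∂ν :=
    hLbar.apply_eq_integral hνI (fun p => (hν p).2) hp v hv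
  have hd : Continuous fun t => Metric.infDist t (Set.range e) := Metric.continuous_infDist_pt _
  have hνe : ∀ᵐ t ∂ν, t ∈ Set.range e := by
    -- The functions `1` and `1 + infDist` agree on the range of `e`, so both compose with `g` to `1
    -- ∈ V`. Their `ν`-integrals coincide, and the distance to the range vanishes almost everywhere.
    have h := (hrep (p := fun t => 1 + Metric.infDist t (Set.range e)) (by fun_prop) ⟨1, h1⟩
      fun x => by simp [Metric.infDist_zero_of_mem (Set.mem_range_self (s x))]).symm.trans
        (hrep (p := fun _ => 1) continuous_const ⟨1, h1⟩ fun x => rfl)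
    rw [integral_add (integrable_const _) (hd.integrable_of_ae_mem_Icc hνI), add_eq_left,
      integral_eq_zero_iff_of_nonneg (fun t => Metric.infDist_nonneg)
        (hd.integrable_of_ae_mem_Icc hνI)] at h
    filter_upwards [h] with t ht
    exact (he.isClosed_range.mem_iff_infDist_zero (Set.range_nonempty e)).2 ht
  have hmap : (ν.comap e).map e = ν := by
    rw [he.measurableEmbedding.map_comap, Measure.restrict_eq_self_of_ae_mem hνe]
  have : IsFiniteMeasure (ν.comap e) := by
    refine ⟨?_⟩
    rw [he.measurableEmbedding.comap_apply]
    exact measure_lt_top _ _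
  refine ⟨(ν.comap e).map f, fun v => ⟨(hV v v.2).integrable_of_compactSpace, ?_⟩⟩
  -- Tietze extension of `v ∘ f` along `e`; then `q ∘ e ∘ s = v ∘ f ∘ s = v`.
  obtain ⟨q, hq⟩ := ContinuousMap.exists_extension he ⟨(v : X → ℝ) ∘ f, (hV v v.2).comp hf⟩
  have hq' : ∀ z, q (e z) = (v : X → ℝ) (f z) := fun z => DFunLike.congr_fun hq z
  calc L v = ∫ t, q t ∂ν := hrep q.continuous v fun x => by rw [hq', hs]
    _ = ∫ z, q (e z) ∂ν.comap e := by rw [← he.measurableEmbedding.integral_map, hmap]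
    _ = ∫ z, (v : X → ℝ) (f z) ∂ν.comap e := by simp only [hq']
    _ = ∫ x, (v : X → ℝ) x ∂(ν.comap e).map f :=
      (integral_map hf.aemeasurable (hV v v.2).aestronglyMeasurable).symm

end

theorem corollary4p5 (n k : ℕ) (hn : 1 ≤ n) (hk : 1 ≤ k)
    (C : Fin k → Set (EuclideanSpace ℝ (Fin n)))
    (hcompact : ∀ i, IsCompact (C i))
    (hpath : ∀ i, IsPathConnected (C i))
    (hdisj : Pairwise fun i j => Disjoint (C i) (C j))
    (K : Set (EuclideanSpace ℝ (Fin n))) (hK : K = ⋃ i, C i) :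
    intervalUnion k ⊆ Set.Icc 0 1 ∧
    ∃ g : K → ℝ, Measurable g ∧ (∀ x, g x ∈ intervalUnion k) ∧
      ∀ V : Submodule ℝ (K → ℝ), (1 : K → ℝ) ∈ V → (∀ v ∈ V, Continuous v) →
        ∀ L : V →ₗ[ℝ] ℝ,
          IsMomentFunctional V.subtype L ↔
            ∃ Lbar : ↥(V ⊔ polySpace g) →ₗ[ℝ] ℝ,
              IsContinuousExtension g L Lbar ∧
                IsMomentFunctionalOn (Set.Icc 0 1) (polyComp (id : ℝ → ℝ))
                  (inducedFunctional Lbar) := by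
  refine ⟨intervalUnion_subset_Icc, ?_⟩
  have hKc : IsCompact K := hK ▸ isCompact_iUnion hcompact
  have : CompactSpace K := isCompact_iff_compactSpace.1 hKc
  have : Nonempty K := by
    obtain ⟨x, hx⟩ := (hpath ⟨0, hk⟩).nonempty
    exact ⟨⟨x, hK ▸ Set.mem_iUnion_of_mem _ hx⟩⟩
  obtain ⟨f, hf, hsurj⟩ := exists_nat_bool_continuous_surjective_of_compact K
  obtain ⟨e, he, heI⟩ := exists_isClosedEmbedding_intervalUnion hk
  obtain ⟨s, hs, hmeas⟩ := exists_measurable_section hf hsurj he.continuous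
  refine ⟨e ∘ s, hmeas, fun x => heI _, fun V h1 hV L => ⟨fun hL => ?_, ?_⟩⟩
  · exact hL.exists_continuousExtension hmeas (fun x => intervalUnion_subset_Icc (heI _)) h1
  · rintro ⟨Lbar, hLbar, hmom⟩
    exact hLbar.isMomentFunctional hf he hs h1 hV hmom
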